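/- Let $G=(P_1,P_2,E)$ be a finite two-colored simple graph: $V=P_1\sqcup P_2$ and every edge joins $P_1$ to $P_2$. Let $|G\rangle=\prod_{uv\in E}CZ_{uv}|+\rangle^{\otimes V}$ be its graph state, one qubit per node. Two nodes are remote if they are non-adjacent in $G$. A vertex $s\in P_i$ is a star vertex if its neighborhood is the whole opposite partition $V\setminus P_i$; $V_i\subseteq P_i$ is the set of non-star vertices of $P_i$. For $v\in P_i$ the opposite remote set is $\overline N(v)=\{u\in V\setminus P_i : uv\notin E\}$, and $\overline N_\cap(B)=\bigcap_{v\in B}\overline N(v)$ for $B\subseteq P_i$. Let $n\ge 1$, and assume that each of $P_1,P_2$ contains at least one star vertex. Let $i\in\{1,2\}$ and $B_g\subseteq V_i$ be such that (a) $|\overline N(v)\setminus\overline N_\cap(B_g)|\ge n-1$ for every $v\in B_g$, and (b) $\bigl(\overline N(u)\setminus\overline N_\cap(B_g)\bigr)\cap\bigl(\overline N(v)\setminus\overline N_\cap(B_g)\bigr)=\emptyset$ for all distinct $u,v\in B_g$. Then $|B_g|$ GHZ states, each on $n$ qubits, can be extracted concurrently among remote nodes from $|G\rangle$. That is, there are pairwise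 disjoint sets $A_1,\dots,A_{|B_g|}\subseteq V$, each consisting of $n$ pairwise remote nodes, and a finite adaptive protocol of single-qubit Clifford gates, single-qubit Pauli measurements and classical communication which, started in $|G\rangle$, ends for every sequence of measurement outcomes of non-zero probability in a state $\bigotimes_k |\mathrm{GHZ}\rangle_{A_k}\otimes|\chi\rangle$, where $|\mathrm{GHZ}\rangle_A=(|0\cdots0\rangle_A+|1\cdots1\rangle_A)/\sqrt2$ and $|\chi\rangle$ is some state of the remaining qubits (depending on the outcomes). The case $n=2$ is the concurrent extraction of $|B_g|$ EPR pairs between remote nodes. -/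

import Mathlib

namespace RemoteExtraction

/-! ### Two-colored graphs

A two-colored graph `G = (P 0, P 1, E)` is a simple graph with a proper coloring
`c : G.Coloring (Fin 2)`; the partition class `P i` is the set of vertices of color `i`. -/

section Graphs

variable {V : Type*} {G : SimpleGraph V}

/-- Opposite remote set of `v`: the vertices of the other partition not adjacent to `v`. -/
def oppRemote (c : G.Coloring (Fin 2)) (v : V) : Set V :=
  {u | c u ≠ c v ∧ ¬ G.Adj v u}

/-- Intersection of the opposite remote sets of the vertices of `B`. -/
def oppRemoteInter (c : G.Coloring (Fin 2)) (B : Finset V) : Set V :=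
  ⋂ v ∈ B, oppRemote c v

/-- The star vertices in partition `i`: their neighborhood is the whole opposite partition. -/
def starSet (c : G.Coloring (Fin 2)) (i : Fin 2) : Set V :=
  {v | c v = i ∧ G.neighborSet v = {u | c u ≠ i}}

/-- The non-star vertices in partition `i`. -/
def nonStarSet (c : G.Coloring (Fin 2)) (i : Fin 2) : Set V :=
  {v | c v = i ∧ v ∉ starSet c i}

/-- Two nodes are remote if the corresponding vertices are non-adjacent. -/
def Remote (G : SimpleGraph V) (u v : V) : Prop := ¬ G.Adj u v

end Graphs

/-! ### States of qubits -/

/-- State vectors of qubits labelled by `V`, in the computational basis `V → Fin 2`. -/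
abbrev QState (V : Type*) := EuclideanSpace ℂ (V → Fin 2)

/-- The graph state `∏_{uv ∈ E} CZ_{uv} |+⟩^{⊗ V}`: the amplitude at `x` is `2^{-|V|/2}` times
one sign `-1` for each edge both of whose endpoints carry the bit `1`. -/
noncomputable def graphState {V : Type*} [Fintype V] [DecidableEq V] (G : SimpleGraph V)
    [DecidableRel G.Adj] : QState V :=
  WithLp.toLp 2 fun x =>
    ((1 / Real.sqrt 2 : ℝ) : ℂ) ^ Fintype.card V *
      ∏ e ∈ G.edgeFinset, if ∀ v ∈ e, x v = 1 then (-1 : ℂ) else 1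

/-- The GHZ state `(|0…0⟩ + |1…1⟩) / √2`; for two qubits it is the EPR pair. -/
noncomputable def ghz (A : Type*) [Fintype A] : QState A :=
  ((1 / Real.sqrt 2 : ℝ) : ℂ) •
    (EuclideanSpace.single (fun _ => 0) 1 + EuclideanSpace.single (fun _ => 1) 1)

/-! ### Local Clifford gates, local Pauli measurements, classical communication -/

/-- The three Pauli observables of a qubit. -/
inductive Pauli
  | X
  | Y
  | Z

/-- The Pauli matrices. -/
noncomputable def Pauli.mat : Pauli → Matrix (Fin 2) (Fin 2) ℂ
  | .X => !![0, 1; 1, 0]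
  | .Y => !![0, -Complex.I; Complex.I, 0]
  | .Z => !![1, 0; 0, -1]

/-- Single-qubit Clifford gates: unitaries that map every Pauli matrix, under conjugation, to a
Pauli matrix up to sign. -/
def IsClifford (U : Matrix (Fin 2) (Fin 2) ℂ) : Prop :=
  U ∈ Matrix.unitaryGroup (Fin 2) ℂ ∧
    ∀ P : Pauli, ∃ Q : Pauli,
      U * P.mat * U.conjTranspose = Q.mat ∨ U * P.mat * U.conjTranspose = -Q.mat

section Protocols

variable {V : Type*} [Fintype V] [DecidableEq V]

/-- The `2 × 2` matrix `M` acting on qubit `v`, tensored with the identity on all other qubits. -/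
noncomputable def applyAt (v : V) (M : Matrix (Fin 2) (Fin 2) ℂ) (ψ : QState V) : QState V :=
  WithLp.toLp 2 fun x => ∑ b : Fin 2, M (x v) b * ψ (Function.update x v b)

/-- The projector `(1 + (-1)^b P) / 2` on the eigenspace of `P` with outcome `(-1)^b`. -/
noncomputable def Pauli.proj (P : Pauli) (b : Fin 2) : Matrix (Fin 2) (Fin 2) ℂ :=
  (1 / 2 : ℂ) • (1 + (-1 : ℂ) ^ (b : ℕ) • P.mat)

/-- An adaptive finite protocol made of single-qubit Clifford gates, single-qubit Pauli
measurements and classical communication: after a measurement, everything that follows, at all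
nodes, may depend on the outcome. -/
inductive Protocol (V : Type*) : Type _
  | halt : Protocol V
  | gate (v : V) (U : Matrix (Fin 2) (Fin 2) ℂ) (hU : IsClifford U) (next : Protocol V) :
      Protocol V
  | measure (v : V) (P : Pauli) (next : Fin 2 → Protocol V) : Protocol V

/-- Started in the state `ψ`, the protocol ends in a state that satisfies `T`, whatever the
measurement outcomes. An outcome occurs with non-zero probability iff the projected vector is
non-zero, and the state is then this vector, normalized. -/
def Protocol.Ensures (T : QState V → Prop) : Protocol V → QState V → Prop
  | .halt, ψ => T ψ
  | .gate v U _ next, ψ => Protocol.Ensures T next (applyAt v U ψ)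
  | .measure v P next, ψ => ∀ b : Fin 2, applyAt v (P.proj b) ψ ≠ 0 →
      Protocol.Ensures T (next b)
        (((‖applyAt v (P.proj b) ψ‖⁻¹ : ℝ) : ℂ) • applyAt v (P.proj b) ψ)

/-- `ψ = (⨂ k, |GHZ⟩ on A k) ⊗ χ` for some state `χ` of the qubits outside all the sets `A k`
(to be used for pairwise disjoint sets `A k`). If `ψ` is a unit vector, so is `χ`; a global phase
is absorbed in `χ`. -/
def HoldsGHZ {r : ℕ} (A : Fin r → Finset V) (ψ : QState V) : Prop :=
  ∃ χ : QState {v : V // ∀ k, v ∉ A k}, χ ≠ 0 ∧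
    ∀ x : V → Fin 2, ψ x = (∏ k, ghz (A k) (fun v => x v)) * χ (fun v => x v)

/-- `r` GHZ states, each on `n` qubits, can be concurrently extracted among remote nodes from the
graph state of `G`: there are pairwise disjoint sets of `n` pairwise remote nodes, and a protocol
which, with certainty, turns the graph state into GHZ states on all of these sets. -/
def RemoteGHZExtractable (G : SimpleGraph V) [DecidableRel G.Adj] (n r : ℕ) : Prop :=
  ∃ A : Fin r → Finset V,
    (∀ k, (A k).card = n) ∧
    (∀ k l, k ≠ l → Disjoint (A k) (A l)) ∧
    (∀ k, ∀ u ∈ A k, ∀ v ∈ A k, u ≠ v → Remote G u v) ∧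
    ∃ p : Protocol V, p.Ensures (HoldsGHZ A) (graphState G)

end Protocols

end RemoteExtraction

/-!
Choose a star vertex `a` in the class of `B` and a star vertex `b` in the other class, and for each
`v ∈ B` a set `S v` of `n - 1` leaves among the vertices remote to `v` but not to all of `B`. By
disjointness a leaf of `v` is adjacent to every other element of `B`, so the graph between `B` and
the leaves is the bipartite complement of the stars with centres `v` and leaves `S v`. As `a` and
`b` are adjacent to everything opposite, pivoting along the edge `ab`, which is what Hadamard gates
on both its ends do to a graph state, complements all edges between the other vertices of the two
classes (`Reach.of_pivot`). Measuring all vertices outside `B` and the leaves in the `Z` basis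
deletes them, up to `Z` gates that depend on the outcomes (`Reach.of_measureZ_pairs`), and leaves a
disjoint union of star graph states. Hadamard gates on the leaves turn these into GHZ states
(`Reach.of_hadamard_leaves`, `holdsGHZ_stars`).

A graph state is handled as a function of the bits: a product of `CZ` phases `czSign`, which are
bilinear in the bits, over pairs of vertices. Since the target property is stable under nonzero
scalars, normalizations and global phases are dropped throughout (`Protocol.Ensures.smul`).
-/

namespace RemoteExtraction

/-! ### Phases of `CZ` gates -/

/-- The `CZ` phase `(-1)^(a * b)` of two bits. -/
noncomputable def czSign (a b : Fin 2) : ℂ := if a = 1 ∧ b = 1 then -1 else 1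

@[simp] lemma czSign_zero_left (b : Fin 2) : czSign 0 b = 1 := by simp [czSign]

@[simp] lemma czSign_zero_right (a : Fin 2) : czSign a 0 = 1 := by simp [czSign]

lemma czSign_comm (a b : Fin 2) : czSign a b = czSign b a := by simp only [czSign, and_comm]

lemma czSign_mul_self (a b : Fin 2) : czSign a b * czSign a b = 1 := by
  unfold czSign; split_ifs <;> norm_num

lemma czSign_add_left (a b d : Fin 2) : czSign (a + b) d = czSign a d * czSign b d := by
  fin_cases a <;> fin_cases b <;> fin_cases d <;> simp [czSign]

lemma czSign_add_right (d a b : Fin 2) : czSign d (a + b) = czSign d a * czSign d b := by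
  simp only [czSign_comm d, czSign_add_left]

lemma czSign_sum_left {ι : Type*} (s : Finset ι) (f : ι → Fin 2) (d : Fin 2) :
    czSign (∑ j ∈ s, f j) d = ∏ j ∈ s, czSign (f j) d := by
  classical
  induction s using Finset.induction_on with
  | empty => simp
  | insert j s hj ih => rw [Finset.sum_insert hj, Finset.prod_insert hj, czSign_add_left, ih]

lemma czSign_sum_right {ι : Type*} (s : Finset ι) (f : ι → Fin 2) (d : Fin 2) :
    czSign d (∑ j ∈ s, f j) = ∏ j ∈ s, czSign d (f j) := by
  simp only [czSign_comm d, czSign_sum_left]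

/-- Two Hadamard sums over the ends `p`, `q` of an edge, whose other neighbours have parities
`s` and `t`: the roles of the two ends are exchanged, and the neighbours get joined. -/
lemma sum_czSign_pivot (y z s t : Fin 2) :
    ∑ q, czSign z q * ∑ p, czSign y p * (czSign p q * czSign p s * czSign t q) =
      2 * czSign (z + t) (y + s) := by
  fin_cases y <;> fin_cases z <;> fin_cases s <;> fin_cases t <;>
    simp [czSign, Fin.sum_univ_two] <;> norm_num

lemma sum_czSign_mul_czSign (y z : Fin 2) :
    ∑ p, czSign y p * czSign z p = 2 * if z = y then 1 else 0 := by
  fin_cases y <;> fin_cases z <;> simp [czSign, Fin.sum_univ_two]; norm_num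

/-! ### Two Clifford gates -/

/-- The Hadamard gate. -/
noncomputable def hadamard : Matrix (Fin 2) (Fin 2) ℂ :=
  ((1 / Real.sqrt 2 : ℝ) : ℂ) • Matrix.of czSign

lemma hadamard_isClifford : IsClifford hadamard := by
  have h2 : ((1 / Real.sqrt 2 : ℝ) : ℂ) * ((1 / Real.sqrt 2 : ℝ) : ℂ) = 1 / 2 := by
    rw [← Complex.ofReal_mul, div_mul_div_comm, Real.mul_self_sqrt (by norm_num)]; norm_num
  have hstar : hadamard.conjTranspose = hadamard := by
    ext j k
    fin_cases j <;> fin_cases k <;>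
      simp [hadamard, czSign, Matrix.conjTranspose_apply, -Complex.ofReal_div,
        -Complex.ofReal_inv, Complex.conj_ofReal]
  have hconj (M : Matrix (Fin 2) (Fin 2) ℂ) : hadamard * M * hadamard.conjTranspose =
      (1 / 2 : ℂ) • (Matrix.of czSign * M * Matrix.of czSign) := by
    rw [hstar, hadamard, Matrix.smul_mul, Matrix.smul_mul, Matrix.mul_smul, smul_smul, h2]
  refine ⟨?_, ?_⟩
  · rw [Matrix.mem_unitaryGroup_iff, Matrix.star_eq_conjTranspose]
    have := hconj 1
    rw [mul_one] at this
    rw [this]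
    ext j k
    fin_cases j <;> fin_cases k <;>
      simp [czSign, Matrix.mul_apply, Fin.sum_univ_two]; norm_num
  · rintro (_ | _ | _)
    · refine ⟨.Z, Or.inl ?_⟩
      rw [hconj]
      ext j k
      fin_cases j <;> fin_cases k <;>
        simp [czSign, Pauli.mat, Matrix.mul_apply, Fin.sum_univ_two] <;> norm_num
    · refine ⟨.Y, Or.inr ?_⟩
      rw [hconj]
      ext j k
      fin_cases j <;> fin_cases k <;>
        simp [czSign, Pauli.mat, Matrix.mul_apply, Fin.sum_univ_two] <;> ring
    · refine ⟨.X, Or.inl ?_⟩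
      rw [hconj]
      ext j k
      fin_cases j <;> fin_cases k <;>
        simp [czSign, Pauli.mat, Matrix.mul_apply, Fin.sum_univ_two] <;> norm_num

lemma pauliZ_isClifford : IsClifford Pauli.Z.mat := by
  have hstar : Pauli.Z.mat.conjTranspose = Pauli.Z.mat := by
    ext j k
    fin_cases j <;> fin_cases k <;> simp [Pauli.mat, Matrix.conjTranspose_apply]
  refine ⟨?_, ?_⟩
  · rw [Matrix.mem_unitaryGroup_iff, Matrix.star_eq_conjTranspose, hstar]
    ext j k
    fin_cases j <;> fin_cases k <;> simp [Pauli.mat, Matrix.mul_apply, Fin.sum_univ_two]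
  · rw [hstar]
    rintro (_ | _ | _)
    · refine ⟨.X, Or.inr ?_⟩
      ext j k
      fin_cases j <;> fin_cases k <;> simp [Pauli.mat, Matrix.mul_apply, Fin.sum_univ_two]
    · refine ⟨.Y, Or.inr ?_⟩
      ext j k
      fin_cases j <;> fin_cases k <;> simp [Pauli.mat, Matrix.mul_apply, Fin.sum_univ_two]
    · refine ⟨.Z, Or.inl ?_⟩
      ext j k
      fin_cases j <;> fin_cases k <;> simp [Pauli.mat, Matrix.mul_apply, Fin.sum_univ_two]

/-! ### Protocols acting on amplitude functions -/

/-- The signs `(-1)^(affine form in the bits)`, as a monoid of functions: these are the diagonal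
operators, up to a global sign, that products of single-qubit `Z` gates implement. -/
def affineSigns (V : Type*) : Submonoid ((V → Fin 2) → ℂ) :=
  Submonoid.closure (insert (fun _ => -1) (Set.range fun v x => czSign 1 (x v)))

lemma czSign_const_mem_affineSigns {V : Type*} (a b : Fin 2) :
    (fun _ => czSign a b) ∈ affineSigns V := by
  unfold czSign
  split_ifs
  · exact Submonoid.subset_closure (Set.mem_insert _ _)
  · exact one_mem _

lemma czSign_left_mem_affineSigns {V : Type*} (a : Fin 2) (v : V) :
    (fun x => czSign a (x v)) ∈ affineSigns V := by
  fin_cases a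
  · simp only [Fin.zero_eta, czSign_zero_left]
    exact one_mem (affineSigns V)
  · exact Submonoid.subset_closure (Set.mem_insert_of_mem _ ⟨v, rfl⟩)

lemma applyAt_smul {V : Type*} [DecidableEq V] (v : V) (M : Matrix (Fin 2) (Fin 2) ℂ) (s : ℂ) (ψ : QState V) :
    applyAt v M (s • ψ) = s • applyAt v M ψ := by
  ext x
  simp only [applyAt, PiLp.smul_apply, smul_eq_mul, Finset.mul_sum]
  exact Finset.sum_congr rfl fun b _ => by ring

section Reach

variable {V : Type*} [Fintype V] [DecidableEq V]

lemma Protocol.Ensures.smul {T : QState V → Prop} (hT : ∀ s : ℂ, s ≠ 0 → ∀ ψ, T ψ → T (s • ψ))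
    {p : Protocol V} {ψ : QState V} (h : p.Ensures T ψ) {s : ℂ} (hs : s ≠ 0) :
    p.Ensures T (s • ψ) := by
  induction p generalizing ψ s with
  | halt => exact hT s hs ψ h
  | gate v U hU next ih =>
    simp only [Protocol.Ensures, applyAt_smul] at h ⊢
    exact ih h hs
  | measure v P next ih =>
    simp only [Protocol.Ensures, applyAt_smul] at h ⊢
    intro b hb
    have hb' : applyAt v (P.proj b) ψ ≠ 0 := fun h0 => hb (by rw [h0, smul_zero])
    have hs' : s * ((‖s‖⁻¹ : ℝ) : ℂ) ≠ 0 :=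
      mul_ne_zero hs (by simpa using hs)
    convert ih b (h b hb') hs' using 1
    rw [norm_smul, mul_inv, smul_smul, smul_smul, Complex.ofReal_mul]
    congr 1
    ring

/-- Some protocol, started in the (not necessarily normalized) state with amplitudes `f`, ends
with certainty in a state satisfying `T`. -/
def Reach (T : QState V → Prop) (f : (V → Fin 2) → ℂ) : Prop :=
  ∃ p : Protocol V, p.Ensures T (WithLp.toLp 2 f)

variable {T : QState V → Prop} {f : (V → Fin 2) → ℂ}

lemma Reach.of_const_mul (hT : ∀ s : ℂ, s ≠ 0 → ∀ ψ, T ψ → T (s • ψ)) {s : ℂ} (hs : s ≠ 0)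
    (h : Reach T fun x => s * f x) : Reach T f := by
  obtain ⟨p, hp⟩ := h
  refine ⟨p, ?_⟩
  convert hp.smul hT (inv_ne_zero hs) using 1
  ext x
  simp [hs]

lemma Reach.of_hadamard (hT : ∀ s : ℂ, s ≠ 0 → ∀ ψ, T ψ → T (s • ψ)) (v : V)
    (h : Reach T fun x => ∑ p, czSign (x v) p * f (Function.update x v p)) : Reach T f := by
  obtain ⟨p, hp⟩ := h
  have hs : ((1 / Real.sqrt 2 : ℝ) : ℂ) ≠ 0 := by
    rw [Complex.ofReal_ne_zero]; positivity
  refine ⟨.gate v hadamard hadamard_isClifford p, ?_⟩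
  change p.Ensures T _
  convert hp.smul hT hs using 1
  ext x
  simp only [applyAt, hadamard, PiLp.smul_apply, smul_eq_mul, Matrix.smul_apply,
    Matrix.of_apply, Finset.mul_sum, mul_assoc]

lemma Reach.of_pauliZ (v : V) (h : Reach T fun x => czSign 1 (x v) * f x) : Reach T f := by
  obtain ⟨p, hp⟩ := h
  refine ⟨.gate v Pauli.Z.mat pauliZ_isClifford p, ?_⟩
  change p.Ensures T _
  convert hp using 1
  ext x
  have hx : Function.update x v (x v) = x := Function.update_eq_self v x
  rcases Fin.exists_fin_two.mp ⟨x v, rfl⟩ with h0 | h0 <;> rw [h0] at hx <;>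
    simp [applyAt, Pauli.mat, Fin.sum_univ_two, h0, hx, czSign]

lemma Reach.of_measureZ (hT : ∀ s : ℂ, s ≠ 0 → ∀ ψ, T ψ → T (s • ψ)) (v : V)
    (h : ∀ b, Reach T fun x => if x v = b then f x else 0) : Reach T f := by
  choose p hp using h
  refine ⟨.measure v .Z p, fun b hb => ?_⟩
  refine Protocol.Ensures.smul hT ?_ (by simpa using hb)
  convert hp b using 1
  ext x
  have hx : Function.update x v (x v) = x := Function.update_eq_self v x
  rcases Fin.exists_fin_two.mp ⟨x v, rfl⟩ with h0 | h0 <;> rw [h0] at hx <;>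
    fin_cases b <;>
    simp [applyAt, Pauli.proj, Pauli.mat, Matrix.one_apply, Fin.sum_univ_two, h0, hx] <;> ring

/-- Measuring all qubits of `R` in the `Z` basis fixes their bits and leaves the other amplitudes
unchanged. -/
lemma Reach.of_measureZ_finset (hT : ∀ s : ℂ, s ≠ 0 → ∀ ψ, T ψ → T (s • ψ)) (R : Finset V)
    (h : ∀ z : V → Fin 2, Reach T fun x => if ∀ w ∈ R, x w = z w then f x else 0) :
    Reach T f := by
  induction R using Finset.induction_on generalizing f with
  | empty => simpa using h
  | insert v R hv ih =>
    refine Reach.of_measureZ hT v fun b => ih fun z => ?_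
    convert h (Function.update z v b) using 2 with x
    have : (∀ w ∈ R, x w = Function.update z v b w) ↔ ∀ w ∈ R, x w = z w :=
      forall₂_congr fun w hw => by
        rw [Function.update_of_ne (ne_of_mem_of_not_mem hw hv)]
    simp only [Finset.forall_mem_insert, Function.update_self, this]
    split_ifs <;> first | rfl | tauto

lemma Reach.of_affineSign_mul (hT : ∀ s : ℂ, s ≠ 0 → ∀ ψ, T ψ → T (s • ψ))
    {g : (V → Fin 2) → ℂ} (hg : g ∈ affineSigns V) (h : Reach T (g * f)) : Reach T f := by
  induction hg using Submonoid.closure_induction generalizing f with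
  | mem g hg =>
    rcases hg with rfl | ⟨v, rfl⟩
    · exact Reach.of_const_mul hT (by norm_num : (-1 : ℂ) ≠ 0) h
    · exact Reach.of_pauliZ v h
  | one => simpa using h
  | mul g g' _ _ ih ih' => exact ih' (ih (by rwa [← mul_assoc]))

/-- Deleting vertices from a graph state: after `Z` measurements on `R`, every `CZ` phase with an
end in `R` is an affine sign in the other bits, so that only the pairs outside `R` remain. -/
lemma Reach.of_measureZ_pairs (hT : ∀ s : ℂ, s ≠ 0 → ∀ ψ, T ψ → T (s • ψ)) (R : Finset V)
    (E : Finset (V × V))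
    (h : ∀ z : V → Fin 2, Reach T fun x => (if ∀ w ∈ R, x w = z w then 1 else 0) *
      ∏ e ∈ E with e.1 ∉ R ∧ e.2 ∉ R, czSign (x e.1) (x e.2)) :
    Reach T fun x => ∏ e ∈ E, czSign (x e.1) (x e.2) := by
  refine Reach.of_measureZ_finset hT R fun z => ?_
  -- `y x` replaces the measured bits by the outcomes, which makes `g` affine for all `x`.
  let y (x : V → Fin 2) (w : V) : Fin 2 := if w ∈ R then z w else x w
  let g : (V → Fin 2) → ℂ := ∏ e ∈ E with ¬ (e.1 ∉ R ∧ e.2 ∉ R),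
    fun x => czSign (y x e.1) (y x e.2)
  refine Reach.of_affineSign_mul hT (g := g) (Submonoid.prod_mem _ fun e he => ?_) ?_
  · have he' := (Finset.mem_filter.mp he).2
    by_cases h1 : e.1 ∈ R <;> by_cases h2 : e.2 ∈ R <;> simp only [y, h1, h2, if_true, if_false]
    · exact czSign_const_mem_affineSigns _ _
    · exact czSign_left_mem_affineSigns _ _
    · simpa only [czSign_comm] using czSign_left_mem_affineSigns (z e.2) e.1
    · exact absurd ⟨h1, h2⟩ he'
  · convert h z using 2 with x
    by_cases hx : ∀ w ∈ R, x w = z w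
    · have hy : y x = x := by
        ext w
        by_cases hw : w ∈ R <;> simp [y, hw, hx]
      simp only [Pi.mul_apply, if_pos hx, one_mul, g, Finset.prod_apply, hy]
      rw [← Finset.prod_filter_mul_prod_filter_not E (fun e => e.1 ∉ R ∧ e.2 ∉ R),
        mul_left_comm, ← Finset.prod_mul_distrib]
      simp only [czSign_mul_self, Finset.prod_const_one, mul_one]
    · simp [if_neg hx]

/-- Hadamard gates on the leaves `L` of a star forest, where `π w` is the centre next to the leaf
`w`, turn `CZ` phases into equalities of bits. -/
lemma Reach.of_hadamard_leaves (hT : ∀ s : ℂ, s ≠ 0 → ∀ ψ, T ψ → T (s • ψ)) (L : Finset V)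
    (π : V → V) (hπ : ∀ w ∈ L, π w ∉ L)
    (hf : ∀ w ∈ L, ∀ x b, f (Function.update x w b) = f x)
    (h : Reach T fun x => f x * ∏ w ∈ L, if x (π w) = x w then 1 else 0) :
    Reach T fun x => f x * ∏ w ∈ L, czSign (x (π w)) (x w) := by
  induction L using Finset.induction_on generalizing f with
  | empty => simpa using h
  | insert v L hv ih =>
    have hπv : π v ≠ v := fun e => hπ v (by simp) (by simp [e])
    have key := ih (f := fun x => f x * czSign (x (π v)) (x v))
      (fun w hw hw' => hπ w (by simp [hw]) (by simp [hw'])) ?_ ?_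
    · simpa only [Finset.prod_insert hv, mul_assoc] using key
    · intro w hw x b
      have h1 : π v ≠ w := fun e => hπ v (by simp) (by simp [e, hw])
      have h2 : v ≠ w := fun e => hv (e ▸ hw)
      simp only [Function.update_of_ne h1, Function.update_of_ne h2, hf w (by simp [hw])]
    · refine Reach.of_hadamard hT v (Reach.of_const_mul hT (s := 1 / 2) (by norm_num) ?_)
      convert h using 2 with x
      have hL (p : Fin 2) : (∏ w ∈ L, if Function.update x v p (π w) = Function.update x v p w
          then (1 : ℂ) else 0) = ∏ w ∈ L, if x (π w) = x w then 1 else 0 := by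
        refine Finset.prod_congr rfl fun w hw => ?_
        rw [Function.update_of_ne (fun e => hπ w (by simp [hw]) (by simp [e])),
          Function.update_of_ne (ne_of_mem_of_not_mem hw hv)]
      simp only [hL, hf v (by simp), Function.update_of_ne hπv, Function.update_self,
        Finset.prod_insert hv]
      have := sum_czSign_mul_czSign (x v) (x (π v))
      calc _ = 1 / 2 * ((∑ p, czSign (x v) p * czSign (x (π v)) p) *
            (f x * ∏ w ∈ L, if x (π w) = x w then 1 else 0)) := by
              rw [Finset.sum_mul]
              congr 1
              exact Finset.sum_congr rfl fun p _ => by ring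
        _ = _ := by rw [this]; ring

end Reach

/-! ### Pivoting and the final GHZ states -/

lemma HoldsGHZ.smul {V : Type*} {r : ℕ} {A : Fin r → Finset V} {s : ℂ} (hs : s ≠ 0) {ψ : QState V}
    (h : HoldsGHZ A ψ) : HoldsGHZ A (s • ψ) := by
  obtain ⟨χ, hχ, h⟩ := h
  refine ⟨s • χ, smul_ne_zero hs hχ, fun x => ?_⟩
  simp only [PiLp.smul_apply, smul_eq_mul, h]
  ring

section Extraction

variable {V : Type*} [Fintype V] [DecidableEq V]

/-- The graph state of a two-colored graph, with its edges listed from color `i` to the other. -/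
lemma graphState_eq (G : SimpleGraph V) [DecidableRel G.Adj] (c : G.Coloring (Fin 2))
    (i : Fin 2) (x : V → Fin 2) :
    graphState G x = ((1 / Real.sqrt 2 : ℝ) : ℂ) ^ Fintype.card V *
      ∏ v with c v = i, ∏ w with c w ≠ i, if G.Adj v w then czSign (x v) (x w) else 1 := by
  change _ * _ = _
  congr 1
  have h : (∏ v with c v = i, ∏ w with c w ≠ i, if G.Adj v w then czSign (x v) (x w) else 1) =
      ∏ e ∈ (Finset.univ.filter fun v => c v = i) ×ˢ (Finset.univ.filter fun w => c w ≠ i) with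
        G.Adj e.1 e.2, czSign (x e.1) (x e.2) := by
    rw [← Finset.prod_product' (f := fun v w => if G.Adj v w then czSign (x v) (x w) else 1),
      ← Finset.prod_filter]
  rw [h]
  symm
  refine Finset.prod_bij (fun e _ => s(e.1, e.2)) ?_ ?_ ?_ ?_
  · intro e he
    simpa using (Finset.mem_filter.mp he).2
  · rintro ⟨v, w⟩ he ⟨v', w'⟩ he' h
    simp only [Finset.mem_filter, Finset.mem_product, Finset.mem_univ, true_and] at he he'
    rcases Sym2.eq_iff.mp h with ⟨rfl, rfl⟩ | ⟨rfl, rfl⟩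
    · rfl
    · exact absurd he.1.1 he'.1.2
  · intro e
    induction e using Sym2.ind with | _ v w => ?_
    intro he
    have hadj : G.Adj v w := by simpa using he
    have hc := c.valid hadj
    by_cases hv : c v = i
    · exact ⟨(v, w), by simp [hv, hadj]; exact fun h => hc (hv.trans h.symm), rfl⟩
    · have hw : c w = i := by omega
      exact ⟨(w, v), by simp [hv, hw, hadj.symm], Sym2.eq_swap⟩
  · intro e _
    simp [czSign]

/-- Pivoting: Hadamard gates on both ends of an edge `ab`, where `a` is adjacent to all vertices
of the other class and `b` to all of the first, complement the edges between the remaining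
vertices `P` and `Q` of the two classes, and exchange the roles of `a` and `b`. -/
lemma Reach.of_pivot {T : QState V → Prop} (hT : ∀ s : ℂ, s ≠ 0 → ∀ ψ, T ψ → T (s • ψ))
    {a b : V} (hab : a ≠ b) {P Q : Finset V} (haP : a ∉ P) (hbP : b ∉ P) (haQ : a ∉ Q)
    (hbQ : b ∉ Q) (r : V → V → Prop) [DecidableRel r]
    (har : ∀ w ∈ insert b Q, r a w) (hbr : ∀ v ∈ P, r v b)
    (h : Reach T fun x => ∏ e ∈ insert b P ×ˢ insert a Q with
      ¬ (e.1 ∈ P ∧ e.2 ∈ Q ∧ r e.1 e.2), czSign (x e.1) (x e.2)) :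
    Reach T fun x => ∏ v ∈ insert a P, ∏ w ∈ insert b Q,
      if r v w then czSign (x v) (x w) else 1 := by
  let F (x : V → Fin 2) : ℂ := ∏ v ∈ P, ∏ w ∈ Q, if r v w then czSign (x v) (x w) else 1
  have hF (x : V → Fin 2) {v : V} (hvP : v ∉ P) (hvQ : v ∉ Q) (p : Fin 2) :
      F (Function.update x v p) = F x :=
    Finset.prod_congr rfl fun u hu => Finset.prod_congr rfl fun w hw => by
      rw [Function.update_of_ne (ne_of_mem_of_not_mem hu hvP),
        Function.update_of_ne (ne_of_mem_of_not_mem hw hvQ)]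
  have hsum (x : V → Fin 2) {v : V} {s : Finset V} (hv : v ∉ s) (p : Fin 2) :
      ∑ w ∈ s, Function.update x v p w = ∑ w ∈ s, x w :=
    Finset.sum_congr rfl fun w hw => Function.update_of_ne (ne_of_mem_of_not_mem hw hv) _ _
  -- The input state, sorted by the edges at `a` and at `b`.
  have hin (x : V → Fin 2) : (∏ v ∈ insert a P, ∏ w ∈ insert b Q,
      if r v w then czSign (x v) (x w) else 1) =
      czSign (x a) (x b) * czSign (x a) (∑ w ∈ Q, x w) * czSign (∑ v ∈ P, x v) (x b) * F x := by
    rw [Finset.prod_insert haP, Finset.prod_congr rfl fun w hw => if_pos (har w hw),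
      Finset.prod_insert hbQ, czSign_sum_right, czSign_sum_left, mul_assoc _ _ (F x),
      ← Finset.prod_mul_distrib]
    congr 1
    refine Finset.prod_congr rfl fun v hv => ?_
    rw [Finset.prod_insert hbQ, if_pos (hbr v hv)]
  -- The output state; the phases of the pairs in `r` occur twice and cancel.
  have hout (x : V → Fin 2) : (∏ e ∈ insert b P ×ˢ insert a Q with
      ¬ (e.1 ∈ P ∧ e.2 ∈ Q ∧ r e.1 e.2), czSign (x e.1) (x e.2)) =
      czSign (x b + ∑ v ∈ P, x v) (x a + ∑ w ∈ Q, x w) * F x := by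
    have h1 : F x = ∏ e ∈ insert b P ×ˢ insert a Q with (e.1 ∈ P ∧ e.2 ∈ Q ∧ r e.1 e.2),
        czSign (x e.1) (x e.2) := by
      simp only [F]
      rw [← Finset.prod_product' (f := fun v w => if r v w then czSign (x v) (x w) else 1),
        ← Finset.prod_filter]
      refine Finset.prod_congr ?_ fun _ _ => rfl
      ext e
      simp only [Finset.mem_filter, Finset.mem_product, Finset.mem_insert]
      tauto
    have h2 : czSign (x b + ∑ v ∈ P, x v) (x a + ∑ w ∈ Q, x w) =
        ∏ e ∈ insert b P ×ˢ insert a Q, czSign (x e.1) (x e.2) := by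
      rw [← Finset.sum_insert hbP, ← Finset.sum_insert haQ, czSign_sum_left,
        Finset.prod_product' (f := fun v w => czSign (x v) (x w))]
      exact Finset.prod_congr rfl fun v _ => czSign_sum_right _ _ _
    rw [h2, h1, ← Finset.prod_filter_mul_prod_filter_not (insert b P ×ˢ insert a Q)
      (fun e => e.1 ∈ P ∧ e.2 ∈ Q ∧ r e.1 e.2), mul_right_comm, ← Finset.prod_mul_distrib]
    simp only [czSign_mul_self, Finset.prod_const_one, one_mul]
  simp only [hin]
  simp only [hout] at h
  refine Reach.of_hadamard hT a (Reach.of_hadamard hT b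
    (Reach.of_const_mul hT (s := 1 / 2) (by norm_num) ?_))
  convert h using 2 with x
  simp only [Function.update_self, Function.update_of_ne hab, Function.update_of_ne hab.symm,
    hF _ haP haQ, hF _ hbP hbQ, hsum _ haP, hsum _ haQ, hsum _ hbP, hsum _ hbQ]
  have := sum_czSign_pivot (x a) (x b) (∑ w ∈ Q, x w) (∑ v ∈ P, x v)
  calc _ = 1 / 2 * ((∑ q, czSign (x b) q * ∑ p, czSign (x a) p * (czSign p q *
        czSign p (∑ w ∈ Q, x w) * czSign (∑ v ∈ P, x v) q)) * F x) := by
        simp only [Finset.sum_mul, mul_assoc]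
    _ = _ := by rw [this]; ring

/-- The amplitudes of a GHZ state: all bits agree with the bit at a chosen centre. -/
lemma ghz_insert_apply {v : V} {L : Finset V} (x : V → Fin 2) :
    ghz ↥(insert v L) (fun w => x w) =
      ((1 / Real.sqrt 2 : ℝ) : ℂ) * ∏ w ∈ L, if x v = x w then 1 else 0 := by
  have h0 (d : Fin 2) : ((fun w : ↥(insert v L) => x w) = fun _ => d) ↔
      x v = d ∧ ∀ w ∈ L, x w = d := by
    simp [funext_iff]
  simp only [ghz, PiLp.smul_apply, PiLp.add_apply, PiLp.single_apply, smul_eq_mul, h0]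
  congr 1
  rw [Finset.prod_ite_zero]
  simp only [Finset.prod_const_one]
  rcases Fin.exists_fin_two.mp ⟨x v, rfl⟩ with h | h <;> simp [h, eq_comm]

/-- The GHZ condition for a state in which the leaves around each centre `v ∈ B` copy the bit of
`v`, while the bits outside all the stars are fixed. -/
lemma holdsGHZ_stars {r : ℕ} (B : Finset V) (k : Fin r ≃ B) (S : V → Finset V)
    (z : V → Fin 2) :
    HoldsGHZ (fun j => insert (k j : V) (S (k j)))
      (WithLp.toLp 2 fun x => (if ∀ w ∈ (B ∪ B.biUnion S)ᶜ, x w = z w then 1 else 0) *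
        ∏ v ∈ B, ∏ w ∈ S v, if x v = x w then 1 else 0) := by
  have hmem (w : V) : w ∈ (B ∪ B.biUnion S)ᶜ ↔ ∀ j, w ∉ insert (k j : V) (S (k j)) := by
    rw [k.forall_congr_left]
    simp only [Finset.mem_compl, Finset.mem_union, Finset.mem_biUnion, Equiv.apply_symm_apply,
      Finset.mem_insert, Subtype.forall]
    grind
  have hs : ((1 / Real.sqrt 2 : ℝ) : ℂ) ≠ 0 := by
    rw [Complex.ofReal_ne_zero]; positivity
  refine ⟨WithLp.toLp 2 fun y =>
    (((1 / Real.sqrt 2 : ℝ) : ℂ) ^ r)⁻¹ * if ∀ w, y w = z w then 1 else 0, ?_, fun x => ?_⟩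
  · intro h
    have := congrArg (fun φ => φ.ofLp fun w => z w) h
    simp at this
  · simp only [ghz_insert_apply, Finset.prod_mul_distrib, Finset.prod_const, Finset.card_univ,
      Fintype.card_fin]
    have h1 : (∏ v ∈ B, ∏ w ∈ S v, if x v = x w then (1 : ℂ) else 0) =
        ∏ j, ∏ w ∈ S (k j), if x (k j) = x w then 1 else 0 := by
      rw [← Finset.prod_coe_sort B, ← k.prod_comp]
    have h2 : (∀ w ∈ (B ∪ B.biUnion S)ᶜ, x w = z w) ↔
        ∀ w : {w : V // ∀ j, w ∉ insert (k j : V) (S (k j))}, x w = z w := by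
      simp only [hmem, Subtype.forall]
    rw [h1]
    simp only [h2]
    field_simp

/-- Extraction from a choice of centres `B`, of one color, and of leaves `S v`, of the other color,
such that every leaf is adjacent to all centres but its own. -/
lemma remoteGHZExtractable_of_leaves (G : SimpleGraph V) [DecidableRel G.Adj]
    (c : G.Coloring (Fin 2)) (hstar : ∀ j, (starSet c j).Nonempty) (i : Fin 2) (n : ℕ)
    (B : Finset V) (S : V → Finset V) (hB : ∀ v ∈ B, v ∈ nonStarSet c i)
    (hS : ∀ v ∈ B, ∀ w ∈ S v, c w ≠ i ∧ ¬ G.Adj v w)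
    (hSB : ∀ u ∈ B, ∀ v ∈ B, u ≠ v → ∀ w ∈ S v, G.Adj u w)
    (hcard : ∀ v ∈ B, (S v).card + 1 = n) :
    RemoteGHZExtractable G n B.card := by
  have hBc (v) (hv : v ∈ B) : c v = i := (hB v hv).1
  have hSown (u) (hu : u ∈ B) (v) (hv : v ∈ B) (w) (hw : w ∈ S v) (hw' : w ∈ S u) : u = v := by
    by_contra huv
    exact (hS u hu w hw').2 (hSB u hu v hv huv w hw)
  have hSnB (v) (hv : v ∈ B) (w) (hw : w ∈ S v) : w ∉ B := fun h => (hS v hv w hw).1 (hBc w h)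
  let k : Fin B.card ≃ B := B.equivFin.symm
  refine ⟨fun j => insert (k j : V) (S (k j)), fun j => ?_, fun j l hjl => ?_, fun j => ?_, ?_⟩
  · rw [Finset.card_insert_of_notMem fun h => hSnB _ (k j).2 _ h (k j).2, hcard _ (k j).2]
  · have hne : (k j : V) ≠ k l := fun h => hjl (k.injective (Subtype.ext h))
    rw [Finset.disjoint_left]
    intro w hw hw'
    rw [Finset.mem_insert] at hw hw'
    rcases hw with rfl | hw <;> rcases hw' with h | hw'
    · exact hne h
    · exact hSnB _ (k l).2 _ hw' (k j).2
    · exact hSnB _ (k j).2 _ hw (h ▸ (k l).2)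
    · exact hne (hSown _ (k j).2 _ (k l).2 w hw' hw)
  · intro u hu v hv _ hadj
    have hk := hBc _ (k j).2
    have hc := c.valid hadj
    rcases Finset.mem_insert.mp hu with rfl | hu' <;> rcases Finset.mem_insert.mp hv with rfl | hv'
    · exact hc rfl
    · exact (hS _ (k j).2 v hv').2 hadj
    · exact (hS _ (k j).2 u hu').2 hadj.symm
    · have h1 := (hS _ (k j).2 u hu').1
      have h2 := (hS _ (k j).2 v hv').1
      omega
  set A : Fin B.card → Finset V := fun j => insert (k j : V) (S (k j))
  have hT : ∀ s : ℂ, s ≠ 0 → ∀ ψ, HoldsGHZ A ψ → HoldsGHZ A (s • ψ) := fun s hs ψ h => h.smul hs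
  obtain ⟨a, ha, haN⟩ := hstar i
  obtain ⟨b, hb, hbN⟩ := hstar (i + 1)
  have hii : i + 1 ≠ i := by omega
  have hbi : c b ≠ i := hb ▸ hii
  have hadja (w) (hw : c w ≠ i) : G.Adj a w := by
    have : w ∈ G.neighborSet a := by rw [haN]; exact hw
    exact this
  have hadjb (v) (hv : c v = i) : G.Adj v b := by
    have : v ∈ G.neighborSet b := by rw [hbN]; change c v ≠ i + 1; rw [hv]; exact hii.symm
    exact this.symm
  have haB : a ∉ B := fun h => (hB a h).2 ⟨ha, haN⟩
  have hbS (v) (hv : v ∈ B) : b ∉ S v := fun h => (hS v hv b h).2 (hadjb v (hBc v hv))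
  let P : Finset V := (Finset.univ.filter fun v => c v = i).erase a
  let Q : Finset V := (Finset.univ.filter fun v => c v ≠ i).erase b
  have hP : insert a P = Finset.univ.filter fun v => c v = i :=
    Finset.insert_erase (by simp [ha])
  have hQ : insert b Q = Finset.univ.filter fun v => c v ≠ i :=
    Finset.insert_erase (by simp [hbi])
  suffices h : Reach (HoldsGHZ A) (graphState G).ofLp from h
  have hg : (graphState G).ofLp = fun x => graphState G x := rfl
  simp only [hg, graphState_eq G c i]
  have hs : ((1 / Real.sqrt 2 : ℝ) : ℂ) ^ Fintype.card V ≠ 0 := by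
    refine pow_ne_zero _ ?_
    rw [Complex.ofReal_ne_zero]; positivity
  refine Reach.of_const_mul hT (inv_ne_zero hs) ?_
  simp only [inv_mul_cancel_left₀ hs]
  rw [← hP, ← hQ]
  refine Reach.of_pivot hT (fun h => hbi (by rw [← h, ha])) (by simp [P]) (by simp [P, hbi])
    (by simp [Q, ha]) (by simp [Q]) G.Adj (fun w hw => hadja w ?_) (fun v hv => hadjb v ?_) ?_
  · rw [hQ] at hw; simpa using hw
  · simpa using (Finset.mem_of_mem_erase hv)
  -- The pivoted graph, induced on the centres and leaves, is the union of the stars.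
  refine Reach.of_measureZ_pairs hT (B ∪ B.biUnion S)ᶜ _ fun z => ?_
  have hE : ((insert b P ×ˢ insert a Q).filter fun e : V × V =>
        ¬ (e.1 ∈ P ∧ e.2 ∈ Q ∧ G.Adj e.1 e.2)).filter (fun e =>
        e.1 ∉ (B ∪ B.biUnion S)ᶜ ∧ e.2 ∉ (B ∪ B.biUnion S)ᶜ) =
      (B ×ˢ B.biUnion S).filter fun e => e.2 ∈ S e.1 := by
    have hv (v : V) : v ∈ insert b P ∧ v ∈ B ∪ B.biUnion S ↔ v ∈ B := by
      simp only [P, Finset.mem_insert, Finset.mem_erase, Finset.mem_filter, Finset.mem_univ,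
        true_and, Finset.mem_union, Finset.mem_biUnion]
      refine ⟨?_, fun hv => ⟨Or.inr ⟨fun h => haB (h ▸ hv), hBc v hv⟩, Or.inl hv⟩⟩
      rintro ⟨hv, hv' | ⟨u, hu, huv⟩⟩
      · exact hv'
      · rcases hv with rfl | hv
        · exact absurd huv (hbS u hu)
        · exact absurd hv.2 (hS u hu v huv).1
    have hw (w : V) : w ∈ insert a Q ∧ w ∈ B ∪ B.biUnion S ↔ w ∈ B.biUnion S := by
      simp only [Q, Finset.mem_insert, Finset.mem_erase, Finset.mem_filter, Finset.mem_univ,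
        true_and, Finset.mem_union, Finset.mem_biUnion]
      refine ⟨?_, fun ⟨u, hu, huw⟩ =>
        ⟨Or.inr ⟨fun h => hbS u hu (h ▸ huw), (hS u hu w huw).1⟩, Or.inr ⟨u, hu, huw⟩⟩⟩
      rintro ⟨hw, hw' | hw'⟩
      · rcases hw with rfl | hw
        · exact absurd hw' haB
        · exact absurd (hBc w hw') hw.2
      · exact hw'
    have hBP (v) (h : v ∈ B) : v ∈ P := Finset.mem_erase.mpr
      ⟨fun e => haB (e ▸ h), Finset.mem_filter.mpr ⟨Finset.mem_univ v, hBc v h⟩⟩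
    have hSQ (v) (hv : v ∈ B) (w) (h : w ∈ S v) : w ∈ Q := Finset.mem_erase.mpr
      ⟨fun e => hbS v hv (e ▸ h), Finset.mem_filter.mpr ⟨Finset.mem_univ w, (hS v hv w h).1⟩⟩
    ext ⟨v, w⟩
    simp only [Finset.mem_filter, Finset.mem_product, Finset.mem_compl, not_not]
    rw [← hv v, ← hw w]
    constructor
    · rintro ⟨⟨⟨h1, h2⟩, h3⟩, h4, h5⟩
      refine ⟨⟨⟨h1, h4⟩, h2, h5⟩, ?_⟩
      have hvB := (hv v).mp ⟨h1, h4⟩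
      obtain ⟨u, hu, huw⟩ := Finset.mem_biUnion.mp ((hw w).mp ⟨h2, h5⟩)
      by_contra hvw
      exact h3 ⟨hBP v hvB, hSQ u hu w huw, hSB v hvB u hu (fun h => hvw (h ▸ huw)) w huw⟩
    · rintro ⟨⟨⟨h1, h4⟩, h2, h5⟩, h6⟩
      exact ⟨⟨⟨h1, h2⟩, fun h => (hS v ((hv v).mp ⟨h1, h4⟩) w h6).2 h.2.2⟩, h4, h5⟩
  rw [hE]
  -- Each leaf has a unique centre.
  let π (w : V) : V := if h : ∃ v ∈ B, w ∈ S v then h.choose else w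
  have hπ (v) (hv : v ∈ B) (w) (hw : w ∈ S v) : π w = v := by
    have h : ∃ v ∈ B, w ∈ S v := ⟨v, hv, hw⟩
    simp only [π, dif_pos h]
    exact hSown _ h.choose_spec.1 v hv w hw h.choose_spec.2
  have hprod (φ : V → V → ℂ) : ∏ e ∈ (B ×ˢ B.biUnion S).filter (fun e => e.2 ∈ S e.1),
      φ e.1 e.2 = ∏ w ∈ B.biUnion S, φ (π w) w := by
    refine Finset.prod_bij (fun e _ => e.2) ?_ ?_ ?_ ?_
    · intro e he
      exact (Finset.mem_product.mp (Finset.mem_filter.mp he).1).2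
    · rintro ⟨v, w⟩ he ⟨v', w'⟩ he' rfl
      simp only [Finset.mem_filter, Finset.mem_product] at he he'
      rw [hSown v he.1.1 v' he'.1.1 w he'.2 he.2]
    · intro w hw
      obtain ⟨v, hv, hw'⟩ := Finset.mem_biUnion.mp hw
      exact ⟨(v, w), by simp only [Finset.mem_filter, Finset.mem_product]; exact ⟨⟨hv, hw⟩, hw'⟩,
        rfl⟩
    · rintro ⟨v, w⟩ he
      simp only [Finset.mem_filter, Finset.mem_product] at he
      rw [hπ v he.1.1 w he.2]
  have hcz (x : V → Fin 2) := hprod fun v w => czSign (x v) (x w)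
  simp only [hcz]
  refine Reach.of_hadamard_leaves hT _ π (fun w hw => ?_) (fun w hw x d => ?_) ⟨.halt, ?_⟩
  · obtain ⟨v, hv, hw⟩ := Finset.mem_biUnion.mp hw
    rw [hπ v hv w hw, Finset.mem_biUnion]
    rintro ⟨u, hu, hvu⟩
    exact hSnB u hu v hvu hv
  · refine if_congr (forall₂_congr fun u hu => ?_) rfl rfl
    rw [Function.update_of_ne]
    rintro rfl
    exact Finset.mem_compl.mp hu (Finset.mem_union_right _ hw)
  · change HoldsGHZ A _
    convert holdsGHZ_stars B k S z using 4 with x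
    rw [Finset.prod_biUnion]
    · exact Finset.prod_congr rfl fun v hv => Finset.prod_congr rfl fun w hw => by
        rw [hπ v hv w hw]
    · intro u hu v hv huv
      rw [Function.onFun, Finset.disjoint_left]
      exact fun w hw hw' => huv (hSown u hu v hv w hw' hw)

end Extraction
end RemoteExtraction

theorem lemma2 {V : Type*} [Fintype V] [DecidableEq V]
    (G : SimpleGraph V) [DecidableRel G.Adj] (c : G.Coloring (Fin 2))
    (n : ℕ) (hn : 1 ≤ n)
    (hstar : ∀ j : Fin 2, (RemoteExtraction.starSet c j).Nonempty)
    (i : Fin 2) (B : Finset V)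
    (hB : ∀ v ∈ B, v ∈ RemoteExtraction.nonStarSet c i)
    (hcard : ∀ v ∈ B, n - 1 ≤
      (RemoteExtraction.oppRemote c v \ RemoteExtraction.oppRemoteInter c B).ncard)
    (hdisj : ∀ u ∈ B, ∀ v ∈ B, u ≠ v →
      (RemoteExtraction.oppRemote c u \ RemoteExtraction.oppRemoteInter c B) ∩
        (RemoteExtraction.oppRemote c v \ RemoteExtraction.oppRemoteInter c B) = ∅) :
    RemoteExtraction.RemoteGHZExtractable G n B.card := by
  classical
  have hD (v : V) : ∃ s : Finset V, v ∈ B → (s.card = n - 1 ∧ ∀ w ∈ s,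
      w ∈ RemoteExtraction.oppRemote c v \ RemoteExtraction.oppRemoteInter c B) := by
    by_cases hv : v ∈ B
    · have h := hcard v hv
      rw [Set.ncard_eq_toFinset_card'] at h
      obtain ⟨s, hs, hs'⟩ := Finset.exists_subset_card_eq h
      exact ⟨s, fun _ => ⟨hs', fun w hw => Set.mem_toFinset.mp (hs hw)⟩⟩
    · exact ⟨∅, fun h => absurd h hv⟩
  choose S hS using hD
  refine RemoteExtraction.remoteGHZExtractable_of_leaves G c hstar i n B S hB
    (fun v hv w hw => ?_) (fun u hu v hv huv w hw => ?_) (fun v hv => ?_)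
  · have h := ((hS v hv).2 w hw).1
    exact ⟨(hB v hv).1 ▸ h.1, h.2⟩
  · by_contra hadj
    have h := (hS v hv).2 w hw
    -- A leaf of `v` remote to `u` would lie in both reduced remote sets.
    have hu' : w ∈ RemoteExtraction.oppRemote c u :=
      ⟨by rw [(hB u hu).1, ← (hB v hv).1]; exact h.1.1, hadj⟩
    have hmem : w ∈ (∅ : Set V) := hdisj u hu v hv huv ▸ ⟨⟨hu', h.2⟩, h⟩
    exact hmem
  · rw [(hS v hv).1]
    omega
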